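/- Let $\sigma$ be the shift $(\sigma x)_i=x_{i+1}$ on $[0,1]^{\mathbb Z}$ and let $S\subset[0,1]^{\mathbb Z}$ be a subshift, i.e. a subset that is closed in the product topology and satisfies $\sigma(S)=S$. Write $x|_0^{n-1}=(x_0,\dots,x_{n-1})$ and $\pi_n(S)=\{x|_0^{n-1}:x\in S\}\subset[0,1]^n$. For a subset $A$ of a compact metric space and $\varepsilon>0$ let $\#(A,\varepsilon)$ be the minimal number of open sets of diameter smaller than $\varepsilon$ that cover $A$, and let $\overline{\dim}_B(A)=\limsup_{\varepsilon\to0}\frac{\log\#(A,\varepsilon)}{\log(1/\varepsilon)}$ (with $\overline{\dim}_B(\emptyset)=0$). The upper mean box dimension of $S$ is $$\overline{\mathrm{mbdim}}(S)=\lim_{n\to\infty}\frac{\overline{\dim}_B(\pi_n(S))}{n},$$ where $[0,1]^n$ carries the maximum-norm distance (the limit exists). For $x,y\in[0,1]^n$ let $\|x-y\|_p=\big(\frac1n\sum_{i=0}^{n-1}|x_i-y_i|^p\big)^{1/p}$ if $1\le p<\infty$, and $\|x-y\|_\infty=\max_i|x_i-y_i|$. For $n,k\ge1$, a map $f:[0,1]^n\to[0,1]^k$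 is linear if it is the restriction of a linear map $\mathbb R^n\to\mathbb R^k$, and a map $g:[0,1]^k\to[0,1]^n$ is $(L,\alpha)$-Hölder in $\|\cdot\|_p$ if $\|g(x)-g(y)\|_p\le L\|x-y\|_p^\alpha$ for all $x,y\in[0,1]^k$. Let $r_{\mathrm{LIN}-\mathcal H^p_{L,\alpha}}(S,0,n)\in[0,\infty]$ be the infimum of $k/n$ over all integers $k\ge1$ for which there are a linear $f:[0,1]^n\to[0,1]^k$ and a $g:[0,1]^k\to[0,1]^n$ that is $(L,\alpha)$-Hölder in $\|\cdot\|_p$ such that $$\mu\big(\{x\in S: g(f(x|_0^{n-1}))\ne x|_0^{n-1}\}\big)=0\quad\text{for every $\sigma$-invariant Borel probability measure $\mu$ on $S$}$$ (the infimum of the empty set is $\infty$), and let $r_{\mathrm{LIN}-\mathcal H^p_{L,\alpha}}(S,0)=\limsup_{n\to\infty}r_{\mathrm{LIN}-\mathcal H^p_{L,\alpha}}(S,0,n)$. Theorem. For every subshift $S\subset[0,1]^{\mathbb Z}$, every $0<\alpha<1$ and every $p\in[1,\infty]$, $$\inf_{L>0}\ r_{\mathrm{LIN}-\mathcal H^p_{L,\alpha}}(S,0)\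 \le\ \frac{2}{1-\alpha}\,\overline{\mathrm{mbdim}}(S).$$ -/

import Mathlib

open Set Filter Topology MeasureTheory
open scoped ENNReal NNReal unitInterval

noncomputable section

namespace AnalogCompression

/-! ### Box dimension -/

/-- The `ε`-covering number `#(A, ρ, ε)`: the minimal `N` such that `A` is covered by `N` open
sets of diameter smaller than `ε`. By compactness such an `N` exists, see
`coveringNumber_spec`. -/
def coveringNumber {X : Type*} [MetricSpace X] [CompactSpace X] (A : Set X) (ε : ℝ) : ℕ :=
  sInf {N : ℕ | ∃ U : Fin N → Set X,
    (∀ i, IsOpen (U i) ∧ Metric.ediam (U i) < ENNReal.ofReal ε) ∧ A ⊆ ⋃ i, U i}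

/-- The upper box-counting (Minkowski) dimension: the upper limit as `ε → 0`, `ε > 0`, of
`log #(A, ρ, ε) / log (1 / ε)`. The quotient does not depend on the base of the logarithm and is
nonnegative for `ε < 1`. (The empty set has dimension `0`.) -/
def upperBoxDim {X : Type*} [MetricSpace X] [CompactSpace X] (A : Set X) : ℝ≥0∞ :=
  limsup (fun ε : ℝ => ENNReal.ofReal (Real.log (coveringNumber A ε) / Real.log (1 / ε)))
    (𝓝[>] (0 : ℝ))

/-! ### Cubes, subshifts and mean box dimension -/

/-- The unit cube `[0,1]^n`; its Mathlib metric is the one given by the maximum norm. -/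
abbrev Cube (n : ℕ) : Type := Fin n → I

/-- A subshift of `[0,1]^ℤ`: a closed set of sequences, invariant under all powers
`(x_i) ↦ (x_{g+i})`, `g ∈ ℤ`, of the shift. -/
abbrev UnitSubshift : Type := SymbolicDynamics.FullShift.Subshift I ℤ

/-- The shift `(σ x)_i = x_{i+1}` on `[0,1]^ℤ`. -/
def shiftMap (x : ℤ → I) : ℤ → I := fun i => x (i + 1)

/-- The word `x|_0^{n-1}`. -/
def word (n : ℕ) (x : ℤ → I) : Cube n := fun i => x ((i : ℕ) : ℤ)

/-- The upper mean box dimension of a subshift, `lim_n (upper box dimension of π_n(S)) / n`;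
the limit exists by `tendsto_meanBoxDim`. -/
def meanBoxDim (S : UnitSubshift) : ℝ≥0∞ :=
  limUnder atTop (fun n : ℕ => upperBoxDim (word n '' S.carrier) / (n : ℝ≥0∞))

/-! ### Regularity classes and compression rates -/

/-- The normalized `ℓ^p` distance on `[0,1]^n`, `p ∈ [1,∞]`; for `p = ∞` it is the maximum
distance, which is the Mathlib distance of a finite product. -/
def lpDist (p : ℝ≥0∞) {n : ℕ} (x y : Cube n) : ℝ :=
  if p = ∞ then dist x y
  else ((1 / (n : ℝ)) * ∑ i, |(x i : ℝ) - (y i : ℝ)| ^ p.toReal) ^ (1 / p.toReal)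

/-- A regularity class: a set of maps `[0,1]^n → [0,1]^k` for all `n`, `k`. -/
abbrev RegularityClass : Type := (n k : ℕ) → Set (Cube n → Cube k)

/-- The class `LIN` of restrictions of linear maps `ℝ^n → ℝ^k`. -/
def linearClass : RegularityClass := fun n k =>
  {f | ∃ F : (Fin n → ℝ) →ₗ[ℝ] (Fin k → ℝ),
    ∀ (x : Cube n) (j : Fin k), (f x j : ℝ) = F (fun i => (x i : ℝ)) j}

/-- The class of `(L, α)`-Hölder maps with respect to the normalized `ℓ^p` distances. -/
def holderClass (p : ℝ≥0∞) (L α : ℝ) : RegularityClass := fun _ _ =>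
  {g | ∀ x y, lpDist p (g x) (g y) ≤ L * lpDist p x y ^ α}

/-- The set `P_σ(S)` of shift-invariant Borel probability measures on `S`, as measures on
`[0,1]^ℤ` giving full mass to `S`. -/
def invariantMeasures (S : UnitSubshift) : Set (Measure (ℤ → I)) :=
  {μ | IsProbabilityMeasure μ ∧ Measure.map shiftMap μ = μ ∧ μ S.carrierᶜ = 0}

/-- The uniform almost lossless analog compression rate of `S` with `n`-block error probability
`ε`: the infimum of `k / n` over all `k ≥ 1` admitting a compressor `f` in `C` and a decompressor
`g` in `D` (it is `∞` if there is no such `k`). -/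
def blockRate (C D : RegularityClass) (S : UnitSubshift) (ε : ℝ≥0) (n : ℕ) : ℝ≥0∞ :=
  ⨅ (k : ℕ) (_ : 1 ≤ k ∧ ∃ f ∈ C n k, ∃ g ∈ D k n, ∀ μ ∈ invariantMeasures S,
    μ {x ∈ S.carrier | g (f (word n x)) ≠ word n x} ≤ (ε : ℝ≥0∞)),
    (k : ℝ≥0∞) / (n : ℝ≥0∞)

/-- The uniform almost lossless analog compression rate of `S` with error probability `ε`. -/
def uniformRate (C D : RegularityClass) (S : UnitSubshift) (ε : ℝ≥0) : ℝ≥0∞ :=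
  limsup (fun n : ℕ => blockRate C D S ε n) atTop

/-! ### Existence of the covers and of the limit used above -/

theorem coveringNumber_spec {X : Type*} [MetricSpace X] [CompactSpace X] (A : Set X) {ε : ℝ}
    (hε : 0 < ε) : ∃ U : Fin (coveringNumber A ε) → Set X,
      (∀ i, IsOpen (U i) ∧ Metric.ediam (U i) < ENNReal.ofReal ε) ∧ A ⊆ ⋃ i, U i := by
  have hne : {N : ℕ | ∃ U : Fin N → Set X,
      (∀ i, IsOpen (U i) ∧ Metric.ediam (U i) < ENNReal.ofReal ε) ∧ A ⊆ ⋃ i, U i}.Nonempty := by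
    obtain ⟨t, -, ht⟩ := isCompact_univ.elim_nhds_subcover
      (fun x : X => Metric.ball x (ε / 3)) (fun x _ => Metric.ball_mem_nhds x (by positivity))
    refine ⟨t.card, fun i => Metric.ball (t.equivFin.symm i : X) (ε / 3), fun i =>
      ⟨Metric.isOpen_ball, ?_⟩, ?_⟩
    · refine lt_of_le_of_lt (b := ENNReal.ofReal (2 * (ε / 3))) ?_ ?_
      · refine Metric.ediam_le fun x hx y hy => ?_
        rw [edist_dist]
        refine ENNReal.ofReal_le_ofReal ?_
        have h1 := Metric.mem_ball.1 hx
        have h2 := Metric.mem_ball'.1 hy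
        linarith [dist_triangle x (t.equivFin.symm i : X) y]
      · exact (ENNReal.ofReal_lt_ofReal_iff hε).2 (by linarith)
    · intro x _
      obtain ⟨y, hy, hxy⟩ := mem_iUnion₂.1 (ht (mem_univ x))
      exact mem_iUnion.2 ⟨t.equivFin ⟨y, hy⟩, by simpa using hxy⟩
  exact Nat.sInf_mem hne

theorem coveringNumber_word_add_le (S : UnitSubshift) (n k : ℕ) {ε : ℝ} (hε : 0 < ε) :
    coveringNumber (word (n + k) '' S.carrier) ε ≤
      coveringNumber (word n '' S.carrier) ε * coveringNumber (word k '' S.carrier) ε := by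
  obtain ⟨U, hU, hcU⟩ := coveringNumber_spec (word n '' S.carrier) hε
  obtain ⟨V, hV, hcV⟩ := coveringNumber_spec (word k '' S.carrier) hε
  refine Nat.sInf_le ⟨fun m => {z | (fun i => z (Fin.castAdd k i)) ∈ U (finProdFinEquiv.symm m).1 ∧
    (fun i => z (Fin.natAdd n i)) ∈ V (finProdFinEquiv.symm m).2}, fun m => ⟨?_, ?_⟩, ?_⟩
  · exact ((hU _).1.preimage (by fun_prop)).inter ((hV _).1.preimage (by fun_prop))
  · refine lt_of_le_of_lt (Metric.ediam_le fun x hx y hy => ?_)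
      (max_lt (hU (finProdFinEquiv.symm m).1).2 (hV (finProdFinEquiv.symm m).2).2)
    refine edist_pi_le_iff.2 fun i => ?_
    refine Fin.addCases (fun i => ?_) (fun i => ?_) i
    · refine le_max_of_le_left (le_trans ?_ (Metric.edist_le_ediam_of_mem hx.1 hy.1))
      exact edist_le_pi_edist (fun i => x (Fin.castAdd k i)) (fun i => y (Fin.castAdd k i)) i
    · refine le_max_of_le_right (le_trans ?_ (Metric.edist_le_ediam_of_mem hx.2 hy.2))
      exact edist_le_pi_edist (fun i => x (Fin.natAdd n i)) (fun i => y (Fin.natAdd n i)) i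
  · rintro _ ⟨x, hx, rfl⟩
    obtain ⟨a, ha⟩ := mem_iUnion.1 (hcU ⟨x, hx, rfl⟩)
    obtain ⟨b, hb⟩ := mem_iUnion.1 (hcV ⟨_, S.mapsTo (n : ℤ) hx, rfl⟩)
    refine mem_iUnion.2 ⟨finProdFinEquiv (a, b), ?_⟩
    rw [mem_ofPred_eq, Equiv.symm_apply_apply]
    refine ⟨ha, ?_⟩
    convert hb using 1
    funext i
    simp [word, SymbolicDynamics.FullShift.shift]

theorem limsup_add_le_ennreal {α : Type*} {l : Filter α} (u v : α → ℝ≥0∞) :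
    limsup (fun a => u a + v a) l ≤ limsup u l + limsup v l := by
  refine ENNReal.le_of_forall_pos_le_add fun δ hδ hlt => ?_
  have hu : limsup u l < limsup u l + (δ / 2 : ℝ≥0) :=
    ENNReal.lt_add_right (ENNReal.add_lt_top.1 hlt).1.ne (by simpa using hδ.ne')
  have hv : limsup v l < limsup v l + (δ / 2 : ℝ≥0) :=
    ENNReal.lt_add_right (ENNReal.add_lt_top.1 hlt).2.ne (by simpa using hδ.ne')
  have hsum : limsup u l + limsup v l + δ =
      (limsup u l + (δ / 2 : ℝ≥0)) + (limsup v l + (δ / 2 : ℝ≥0)) := by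
    rw [add_add_add_comm, ← ENNReal.coe_add, add_halves]
  rw [hsum]
  refine limsup_le_of_le (by isBoundedDefault) ?_
  filter_upwards [eventually_lt_of_limsup_lt hu, eventually_lt_of_limsup_lt hv] with a h1 h2
  exact add_le_add h1.le h2.le

theorem upperBoxDim_word_add_le (S : UnitSubshift) (n k : ℕ) :
    upperBoxDim (word (n + k) '' S.carrier) ≤
      upperBoxDim (word n '' S.carrier) + upperBoxDim (word k '' S.carrier) := by
  refine le_trans (limsup_le_limsup ?_ (by isBoundedDefault) (by isBoundedDefault))
    (limsup_add_le_ennreal _ _)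
  filter_upwards [Ioo_mem_nhdsGT (show (0 : ℝ) < 1 by norm_num)] with ε hε
  have hlog : 0 ≤ Real.log (1 / ε) := Real.log_nonneg (by rw [le_div_iff₀ hε.1]; linarith [hε.2])
  rw [← ENNReal.ofReal_add (div_nonneg (Real.log_natCast_nonneg _) hlog)
    (div_nonneg (Real.log_natCast_nonneg _) hlog), ← add_div]
  refine ENNReal.ofReal_le_ofReal (div_le_div_of_nonneg_right ?_ hlog)
  have hle := coveringNumber_word_add_le S n k hε.1
  rcases Nat.eq_zero_or_pos (coveringNumber (word (n + k) '' S.carrier) ε) with h0 | h0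
  · rw [h0, Nat.cast_zero, Real.log_zero]
    exact add_nonneg (Real.log_natCast_nonneg _) (Real.log_natCast_nonneg _)
  · have hpos := Nat.pos_of_mul_pos_left (lt_of_lt_of_le h0 hle)
    have hpos' := Nat.pos_of_mul_pos_right (lt_of_lt_of_le h0 hle)
    rw [← Real.log_mul (by positivity) (by positivity)]
    exact Real.log_le_log (by exact_mod_cast h0) (by exact_mod_cast hle)

theorem coveringNumber_cube_one_le (A : Set (Cube 1)) {ε : ℝ} (hε : 0 < ε) (hε1 : ε < 1) :
    (coveringNumber A ε : ℝ) ≤ 4 / ε := by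
  have hle : coveringNumber A ε ≤ ⌊3 / ε⌋₊ + 1 := by
    refine Nat.sInf_le ⟨fun m => {z | |(z 0 : ℝ) - m * (ε / 3)| < ε / 3}, fun m => ⟨?_, ?_⟩, ?_⟩
    · exact isOpen_lt (by fun_prop) (by fun_prop)
    · refine lt_of_le_of_lt (b := ENNReal.ofReal (2 * (ε / 3))) ?_
        ((ENNReal.ofReal_lt_ofReal_iff hε).2 (by linarith))
      refine Metric.ediam_le fun x hx y hy => edist_pi_le_iff.2 fun i => ?_
      rw [Subsingleton.elim i 0, edist_dist, Subtype.dist_eq, Real.dist_eq]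
      refine ENNReal.ofReal_le_ofReal ?_
      have h1 := abs_lt.1 (show |(x 0 : ℝ) - m * (ε / 3)| < ε / 3 from hx)
      have h2 := abs_lt.1 (show |(y 0 : ℝ) - m * (ε / 3)| < ε / 3 from hy)
      exact abs_le.2 ⟨by linarith [h1.1, h2.2], by linarith [h1.2, h2.1]⟩
    · intro z _
      have hz0 : 0 ≤ (z 0 : ℝ) := (z 0).2.1
      have hz1 : (z 0 : ℝ) ≤ 1 := (z 0).2.2
      have hdiv : (z 0 : ℝ) / (ε / 3) ≤ 3 / ε := by
        rw [div_le_div_iff₀ (by positivity) hε]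
        nlinarith
      refine mem_iUnion.2 ⟨⟨⌊(z 0 : ℝ) / (ε / 3)⌋₊, Nat.lt_succ_of_le (Nat.floor_le_floor hdiv)⟩, ?_⟩
      have h1 := Nat.floor_le (show 0 ≤ (z 0 : ℝ) / (ε / 3) by positivity)
      have h2 := Nat.lt_floor_add_one ((z 0 : ℝ) / (ε / 3))
      rw [le_div_iff₀ (by positivity)] at h1
      rw [div_lt_iff₀ (by positivity)] at h2
      change |(z 0 : ℝ) - (⌊(z 0 : ℝ) / (ε / 3)⌋₊ : ℝ) * (ε / 3)| < ε / 3
      exact abs_lt.2 ⟨by linarith, by linarith⟩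
  have hfl := Nat.floor_le (show 0 ≤ 3 / ε by positivity)
  have hone : 1 ≤ 1 / ε := by rw [le_div_iff₀ hε]; linarith
  have hcast : (coveringNumber A ε : ℝ) ≤ (⌊3 / ε⌋₊ : ℝ) + 1 := by exact_mod_cast hle
  calc (coveringNumber A ε : ℝ) ≤ 3 / ε + 1 / ε := by linarith
    _ = 4 / ε := by ring

theorem upperBoxDim_cube_one_le (A : Set (Cube 1)) : upperBoxDim A ≤ 2 := by
  refine limsup_le_of_le (by isBoundedDefault) ?_
  filter_upwards [Ioo_mem_nhdsGT (show (0 : ℝ) < 1 / 4 by norm_num)] with ε hε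
  have h4 : 4 ≤ 1 / ε := by rw [le_div_iff₀ hε.1]; linarith [hε.2]
  have hlog : 0 < Real.log (1 / ε) := Real.log_pos (by linarith)
  rw [show (2 : ℝ≥0∞) = ENNReal.ofReal 2 by simp]
  refine ENNReal.ofReal_le_ofReal ((div_le_iff₀ hlog).2 ?_)
  rcases Nat.eq_zero_or_pos (coveringNumber A ε) with h0 | h0
  · rw [h0, Nat.cast_zero, Real.log_zero]; positivity
  · have hle := coveringNumber_cube_one_le A hε.1 (by linarith [hε.2])
    calc Real.log (coveringNumber A ε) ≤ Real.log (1 / ε * (1 / ε)) := by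
          refine Real.log_le_log (by exact_mod_cast h0) (hle.trans ?_)
          have : 0 < 1 / ε := by linarith
          calc 4 / ε = 4 * (1 / ε) := by ring
            _ ≤ 1 / ε * (1 / ε) := by gcongr
      _ = 2 * Real.log (1 / ε) := by
          rw [Real.log_mul (by linarith) (by linarith)]; ring

/-- The limit in the definition of the mean box dimension exists. -/
theorem tendsto_meanBoxDim (S : UnitSubshift) :
    Tendsto (fun n : ℕ => upperBoxDim (word n '' S.carrier) / (n : ℝ≥0∞)) atTop
      (𝓝 (meanBoxDim S)) := by
  have hfin : ∀ n : ℕ, upperBoxDim (word (n + 1) '' S.carrier) ≠ ∞ := by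
    intro n
    induction n with
    | zero => exact ne_top_of_le_ne_top (by simp) (upperBoxDim_cube_one_le _)
    | succ n ih =>
      exact ne_top_of_le_ne_top (ENNReal.add_ne_top.2 ⟨ih, ne_top_of_le_ne_top (by simp)
        (upperBoxDim_cube_one_le _)⟩) (upperBoxDim_word_add_le S (n + 1) 1)
  have hfin' : ∀ n : ℕ, upperBoxDim (word n '' S.carrier) ≠ ∞ := by
    intro n
    rcases n with _ | n
    · refine ne_top_of_le_ne_top ENNReal.zero_ne_top (limsup_le_of_le (by isBoundedDefault) ?_)
      filter_upwards [self_mem_nhdsWithin] with ε hε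
      have hle : coveringNumber (word 0 '' S.carrier) ε ≤ 1 :=
        Nat.sInf_le ⟨fun _ => univ, fun _ => ⟨isOpen_univ, by
          rw [Metric.ediam_subsingleton subsingleton_univ]
          exact ENNReal.ofReal_pos.2 hε⟩, fun z _ => mem_iUnion.2 ⟨0, mem_univ z⟩⟩
      interval_cases coveringNumber (word 0 '' S.carrier) ε <;> simp
    · exact hfin n
  have hsub : Subadditive (fun n => (upperBoxDim (word n '' S.carrier)).toReal) := by
    intro m n
    rw [← ENNReal.toReal_add (hfin' m) (hfin' n)]
    exact ENNReal.toReal_mono (ENNReal.add_ne_top.2 ⟨hfin' m, hfin' n⟩)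
      (upperBoxDim_word_add_le S m n)
  have hlim := hsub.tendsto_lim ⟨0, by rintro _ ⟨n, rfl⟩; positivity⟩
  refine tendsto_nhds_limUnder ⟨ENNReal.ofReal hsub.lim, ?_⟩
  refine (ENNReal.tendsto_ofReal hlim).congr' ?_
  filter_upwards [eventually_gt_atTop 0] with n hn
  rw [ENNReal.ofReal_div_of_pos (by exact_mod_cast hn), ENNReal.ofReal_toReal (hfin' n),
    ENNReal.ofReal_natCast]

end AnalogCompression

end

namespace AnalogCompression

/-! Fix a block length `m` and let `d` be the upper box dimension of `A = π_m(S)`. If `k (1 - α) > 2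
d`, then almost every `k × m` matrix with independent uniform entries in `[0,1]` is injective on `A`
with an `α`-Hölder inverse. To see this, take `D` slightly above `d` and cover `A` by at most `ε ^
(-D)` sets of diameter below `ε`. For one pair of these sets containing points `ε ^ α` apart, a
random matrix brings such points within `ε` with probability `O(ε ^ (k (1 - α)))`. Over all pairs
this gives `O(ε ^ (k (1 - α) - 2 D))`, which is summable over `ε = 2 ^ (-j)`, so Borel–Cantelli
leaves only finitely many bad scales (`exists_linear_holder_embedding`). A McShane extension makes
the inverse a decoder on the whole cube (`exists_holder_leftInvOn`).

Longer words are cut into blocks of length `m` that are coded separately, with a remainder copied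
unchanged. By shift invariance every block of a point of `S` lies in `A`, so decoding is exact at
every point of `S`. The Hölder constant does not depend on the number of blocks
(`blockMap_mem_holderClass`), so a single `L` serves all `n` and the rate is at most `k / m`.
Rounding `2 d / (1 - α)` up to an integer `k` costs at most `1 / m`, which vanishes as `m → ∞`. -/

/-! ### Random matrices rarely collapse separated points -/

theorem volume_abs_mul_add_le {c : ℝ} (hc : c ≠ 0) (b ρ : ℝ) :
    volume {t : I | |(t : ℝ) * c + b| ≤ ρ} ≤ ENNReal.ofReal (2 * ρ / |c|) := by
  rw [← volume_image_subtype_coe measurableSet_Icc]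
  have hsub : (Subtype.val '' {t : I | |(t : ℝ) * c + b| ≤ ρ}) ⊆
      Metric.closedBall (-b / c) (ρ / |c|) := by
    rintro _ ⟨t, ht, rfl⟩
    rw [Metric.mem_closedBall, Real.dist_eq, le_div_iff₀ (abs_pos.2 hc), ← abs_mul]
    have heq : ((t : ℝ) - -b / c) * c = t * c + b := by
      rw [sub_mul, div_mul_cancel₀ _ hc, sub_neg_eq_add]
    rw [heq]
    exact ht
  refine (measure_mono hsub).trans ?_
  rw [Real.volume_closedBall, mul_div_assoc]

/-- Fubini: once all coordinates of `a` except the `i`-th are frozen, the condition confines `a i`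
to an interval of length `2 * ρ / |z i|`. -/
theorem volume_abs_sum_mul_le {m : ℕ} (z : Fin m → ℝ) {i : Fin m} (hi : z i ≠ 0) (ρ : ℝ) :
    volume {a : Cube m | |∑ j, (a j : ℝ) * z j| ≤ ρ} ≤ ENNReal.ofReal (2 * ρ / |z i|) := by
  obtain _ | m := m
  · exact i.elim0
  let E : Set (I × (Fin m → I)) :=
    {q | |(q.1 : ℝ) * z i + ∑ j, (q.2 j : ℝ) * z (i.succAbove j)| ≤ ρ}
  have hmeas : MeasurableSet E := (isClosed_le (by fun_prop) continuous_const).measurableSet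
  have hpre : {a : Cube (m + 1) | |∑ j, (a j : ℝ) * z j| ≤ ρ} =
      MeasurableEquiv.piFinSuccAbove (fun _ => I) i ⁻¹' E := by
    ext a
    change |∑ j, (a j : ℝ) * z j| ≤ ρ ↔
      |(a i : ℝ) * z i + ∑ j, (a (i.succAbove j) : ℝ) * z (i.succAbove j)| ≤ ρ
    rw [Fin.sum_univ_succAbove _ i]
  have hvol : volume (MeasurableEquiv.piFinSuccAbove (fun _ => I) i ⁻¹' E) = volume E :=
    (volume_preserving_piFinSuccAbove (fun _ => I) i).measure_preimage hmeas.nullMeasurableSet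
  have hprod : volume E = ∫⁻ b : Fin m → I, volume ((fun t => (t, b)) ⁻¹' E) :=
    Measure.prod_apply_symm hmeas
  rw [hpre, hvol, hprod]
  calc ∫⁻ b : Fin m → I, volume ((fun t => (t, b)) ⁻¹' E)
      ≤ ∫⁻ _b : Fin m → I, ENNReal.ofReal (2 * ρ / |z i|) :=
        lintegral_mono fun b => volume_abs_mul_add_le hi (∑ j, (b j : ℝ) * z (i.succAbove j)) ρ
    _ = ENNReal.ofReal (2 * ρ / |z i|) := by
        rw [lintegral_const, measure_univ, mul_one]

theorem volume_forall_abs_sum_mul_le {m k : ℕ} (z : Fin m → ℝ) {i : Fin m} (hi : z i ≠ 0)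
    (ρ : ℝ) : volume {a : Fin k → Cube m | ∀ r, |∑ j, (a r j : ℝ) * z j| ≤ ρ} ≤
      ENNReal.ofReal (2 * ρ / |z i|) ^ k := by
  have hpi : {a : Fin k → Cube m | ∀ r, |∑ j, (a r j : ℝ) * z j| ≤ ρ} =
      Set.pi univ fun _ => {a : Cube m | |∑ j, (a j : ℝ) * z j| ≤ ρ} := by
    ext a; simp
  rw [hpi, volume_pi_pi]
  refine (Finset.prod_le_prod' fun r _ => volume_abs_sum_mul_le z hi ρ).trans ?_
  simp

theorem abs_sum_mul_sub_le {m : ℕ} (a x y : Cube m) :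
    |∑ j, (a j : ℝ) * ((x j : ℝ) - y j)| ≤ m * dist x y := by
  refine (Finset.abs_sum_le_sum_abs _ _).trans ?_
  calc ∑ j, |(a j : ℝ) * ((x j : ℝ) - y j)| ≤ ∑ _j : Fin m, dist x y := by
        refine Finset.sum_le_sum fun j _ => ?_
        rw [abs_mul, abs_of_nonneg (a j).2.1]
        refine (mul_le_of_le_one_left (abs_nonneg _) (a j).2.2).trans ?_
        exact dist_le_pi_dist x y j
    _ = m * dist x y := by simp

/-- The matrices whose action brings two `δ`-separated points of `A` within `ε` of each other. -/
def collapsingMatrices {m : ℕ} (k : ℕ) (A : Set (Cube m)) (δ ε : ℝ) : Set (Fin k → Cube m) :=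
  {a | ∃ x ∈ A, ∃ y ∈ A, δ ≤ dist x y ∧ ∀ r, |∑ j, (a r j : ℝ) * ((x j : ℝ) - y j)| ≤ ε}

/-- Union bound over pairs of covering sets. The constant `2 * m + 1` pays for replacing all points
of a pair of sets by one fixed reference pair: each replacement moves a row sum by at most `m * ε`.
-/
theorem volume_collapsingMatrices_le {m : ℕ} (k : ℕ) (A : Set (Cube m)) {δ ε : ℝ} (hδ : 0 < δ)
    (hε : 0 < ε) : volume (collapsingMatrices k A δ ε) ≤
      (coveringNumber A ε : ℝ≥0∞) ^ 2 * ENNReal.ofReal (2 * ((2 * m + 1) * ε) / δ) ^ k := by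
  obtain ⟨U, hU, hcU⟩ := coveringNumber_spec A hε
  have hdist : ∀ i, ∀ x ∈ U i, ∀ y ∈ U i, dist x y ≤ ε := by
    intro i x hx y hy
    have h := (Metric.edist_le_ediam_of_mem hx hy).trans (hU i).2.le
    rwa [edist_dist, ENNReal.ofReal_le_ofReal_iff hε.le] at h
  have hsub : collapsingMatrices k A δ ε ⊆
      ⋃ q : Fin (coveringNumber A ε) × Fin (coveringNumber A ε),
        collapsingMatrices k A δ ε ∩ {a | ∃ x ∈ U q.1, ∃ y ∈ U q.2, δ ≤ dist x y ∧
          ∀ r, |∑ j, (a r j : ℝ) * ((x j : ℝ) - y j)| ≤ ε} := by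
    rintro a ⟨x, hx, y, hy, h1, h2⟩
    obtain ⟨i, hi⟩ := mem_iUnion.1 (hcU hx)
    obtain ⟨j, hj⟩ := mem_iUnion.1 (hcU hy)
    exact mem_iUnion.2 ⟨(i, j), ⟨x, hx, y, hy, h1, h2⟩, x, hi, y, hj, h1, h2⟩
  refine (measure_mono hsub).trans ((measure_iUnion_fintype_le _ _).trans ?_)
  have hterm : ∀ q : Fin (coveringNumber A ε) × Fin (coveringNumber A ε),
      volume (collapsingMatrices k A δ ε ∩ {a | ∃ x ∈ U q.1, ∃ y ∈ U q.2, δ ≤ dist x y ∧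
        ∀ r, |∑ j, (a r j : ℝ) * ((x j : ℝ) - y j)| ≤ ε}) ≤
      ENNReal.ofReal (2 * ((2 * m + 1) * ε) / δ) ^ k := by
    intro q
    refine (measure_mono inter_subset_right).trans ?_
    -- The reference pair is any `δ`-separated pair; without one, this pair of sets contributes
    -- nothing.
    by_cases hex : ∃ x₀ ∈ U q.1, ∃ y₀ ∈ U q.2, δ ≤ dist x₀ y₀
    · obtain ⟨x₀, hx₀, y₀, hy₀, hd⟩ := hex
      obtain ⟨i, hi⟩ : ∃ i, δ ≤ |(x₀ i : ℝ) - y₀ i| := by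
        by_contra! hcon
        exact absurd ((dist_pi_lt_iff hδ).2 hcon) (not_lt.2 hd)
      have hz : (x₀ i : ℝ) - y₀ i ≠ 0 := abs_pos.1 (hδ.trans_le hi)
      refine (measure_mono ?_).trans ((volume_forall_abs_sum_mul_le (k := k)
        (fun j => (x₀ j : ℝ) - y₀ j) hz ((2 * m + 1) * ε)).trans ?_)
      · rintro a ⟨x, hx, y, hy, -, h⟩ r
        have h1 := (abs_sum_mul_sub_le (a r) x₀ x).trans
          (mul_le_mul_of_nonneg_left (hdist _ x₀ hx₀ x hx) (Nat.cast_nonneg m))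
        have h2 := (abs_sum_mul_sub_le (a r) y y₀).trans
          (mul_le_mul_of_nonneg_left (hdist _ y hy y₀ hy₀) (Nat.cast_nonneg m))
        have hsplit : ∑ j, (a r j : ℝ) * ((x₀ j : ℝ) - y₀ j) =
            ∑ j, (a r j : ℝ) * ((x₀ j : ℝ) - x j) + ∑ j, (a r j : ℝ) * ((x j : ℝ) - y j) +
              ∑ j, (a r j : ℝ) * ((y j : ℝ) - y₀ j) := by
          rw [← Finset.sum_add_distrib, ← Finset.sum_add_distrib]
          exact Finset.sum_congr rfl fun j _ => by ring
        change |∑ j, (a r j : ℝ) * ((x₀ j : ℝ) - y₀ j)| ≤ _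
        rw [hsplit]
        refine (abs_add_three _ _ _).trans ?_
        linarith [h r]
      · gcongr
    · refine le_of_eq_of_le ?_ zero_le
      convert measure_empty (μ := (volume : Measure (Fin k → Cube m)))
      refine eq_empty_of_forall_notMem ?_
      rintro a ⟨x, hx, y, hy, h, -⟩
      exact hex ⟨x, hx, y, hy, h⟩
  refine (Finset.sum_le_sum fun q _ => hterm q).trans ?_
  simp [sq]

theorem eventually_coveringNumber_le {X : Type*} [MetricSpace X] [CompactSpace X] {A : Set X}
    {D : ℝ} (hD : upperBoxDim A < ENNReal.ofReal D) :
    ∀ᶠ ε : ℝ in 𝓝[>] 0, (coveringNumber A ε : ℝ) ≤ ε ^ (-D) := by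
  filter_upwards [eventually_lt_of_limsup_lt hD,
    Ioo_mem_nhdsGT (show (0 : ℝ) < 1 by norm_num)] with ε h hε
  have hlog : 0 < Real.log (1 / ε) := Real.log_pos (by rw [lt_div_iff₀ hε.1]; linarith [hε.2])
  rcases Nat.eq_zero_or_pos (coveringNumber A ε) with h0 | h0
  · rw [h0, Nat.cast_zero]
    exact Real.rpow_nonneg hε.1.le _
  · have h2 := (ENNReal.ofReal_lt_ofReal_iff_of_nonneg
      (div_nonneg (Real.log_natCast_nonneg _) hlog.le)).1 h
    rw [div_lt_iff₀ hlog] at h2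
    rw [← Real.log_le_log_iff (by exact_mod_cast h0) (Real.rpow_pos_of_pos hε.1 _),
      Real.log_rpow hε.1]
    refine h2.le.trans (le_of_eq ?_)
    rw [one_div, Real.log_inv]
    ring

/-- Borel–Cantelli along dyadic scales: with `ε = 2 ^ (-j)` and `δ = ε ^ α`, the volume bound is a
constant times `ε ^ (k * (1 - α) - 2 * D)`, a convergent geometric series by `hk`. -/
theorem ae_eventually_notMem_collapsingMatrices {m k : ℕ} {A : Set (Cube m)} {α D : ℝ}
    (hD : upperBoxDim A < ENNReal.ofReal D) (hk : 2 * D < k * (1 - α)) :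
    ∀ᵐ a : Fin k → Cube m, ∀ᶠ j : ℕ in atTop,
      a ∉ collapsingMatrices k A (((1 / 2 : ℝ) ^ j) ^ α) ((1 / 2 : ℝ) ^ j) := by
  have hlim : Tendsto (fun j : ℕ => (1 / 2 : ℝ) ^ j) atTop (𝓝[>] 0) :=
    tendsto_nhdsWithin_iff.2 ⟨tendsto_pow_atTop_nhds_zero_of_lt_one (by norm_num) (by norm_num),
      Eventually.of_forall fun j => by simp⟩
  obtain ⟨J, hJ⟩ := eventually_atTop.1 (hlim.eventually (eventually_coveringNumber_le hD))
  set C : ℝ := 2 * (2 * m + 1) with hC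
  set s : ℝ := (1 / 2 : ℝ) ^ (k * (1 - α) - 2 * D) with hs
  have hs0 : 0 < s := by positivity
  have hs1 : s < 1 := Real.rpow_lt_one (by norm_num) (by norm_num) (by linarith)
  have hbound : ∀ j : ℕ, J ≤ j →
      volume (collapsingMatrices k A (((1 / 2 : ℝ) ^ j) ^ α) ((1 / 2 : ℝ) ^ j)) ≤
        ENNReal.ofReal (C ^ k * s ^ j) := by
    intro j hj
    have hε : (0 : ℝ) < (1 / 2 : ℝ) ^ j := by positivity
    refine (volume_collapsingMatrices_le k A (Real.rpow_pos_of_pos hε α) hε).trans ?_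
    rw [← ENNReal.ofReal_natCast, ← ENNReal.ofReal_pow (by positivity),
      ← ENNReal.ofReal_pow (by positivity), ← ENNReal.ofReal_mul (by positivity)]
    refine ENNReal.ofReal_le_ofReal ?_
    refine (mul_le_mul_of_nonneg_right (pow_le_pow_left₀ (Nat.cast_nonneg _) (hJ j hj) 2)
      (by positivity)).trans (le_of_eq ?_)
    have hsj : s ^ j = ((1 / 2 : ℝ) ^ j) ^ (k * (1 - α) - 2 * D) := by
      rw [hs, ← Real.rpow_natCast, ← Real.rpow_mul (by norm_num), mul_comm,
        Real.rpow_mul (by norm_num), Real.rpow_natCast]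
    rw [hsj]
    generalize (1 / 2 : ℝ) ^ j = ε at hε
    have h1 : (ε ^ (-D)) ^ 2 = ε ^ (-D * 2) := by
      rw [← Real.rpow_natCast, ← Real.rpow_mul hε.le, Nat.cast_ofNat]
    have h2 : 2 * ((2 * m + 1) * ε) / ε ^ α = C * ε ^ (1 - α) := by
      rw [Real.rpow_sub hε, Real.rpow_one]
      ring
    rw [h1, h2, mul_pow, ← Real.rpow_natCast (ε ^ (1 - α)), ← Real.rpow_mul hε.le,
      mul_left_comm, ← Real.rpow_add hε]
    congr 2
    ring
  have hsum : ∑' j : ℕ, volume (collapsingMatrices k A (((1 / 2 : ℝ) ^ (j + J)) ^ α)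
      ((1 / 2 : ℝ) ^ (j + J))) ≠ ∞ := by
    have hsm : Summable fun j : ℕ => C ^ k * s ^ (j + J) :=
      ((summable_nat_add_iff J).2 (summable_geometric_of_lt_one hs0.le hs1)).mul_left _
    exact ne_top_of_le_ne_top hsm.tsum_ofReal_ne_top
      (ENNReal.tsum_le_tsum fun j => hbound _ (Nat.le_add_left J j))
  filter_upwards [ae_eventually_notMem hsum] with a ha
  obtain ⟨j₀, h⟩ := eventually_atTop.1 ha
  refine eventually_atTop.2 ⟨j₀ + J, fun j hj => ?_⟩
  have := h (j - J) (by omega)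
  rwa [Nat.sub_add_cancel (by omega)] at this

/-! ### Linear encoder and Hölder decoder for one block -/

/-- A set of small upper box dimension embeds linearly, with Hölder inverse, in a cube. -/
theorem exists_linear_holder_embedding {m k : ℕ} {A : Set (Cube m)} {α : ℝ} (hα0 : 0 < α)
    (hdim : upperBoxDim A ≠ ∞) (hk : 2 * (upperBoxDim A).toReal < k * (1 - α)) :
    ∃ f ∈ linearClass m k, ∃ L : ℝ, 1 ≤ L ∧
      ∀ x ∈ A, ∀ y ∈ A, dist x y ≤ L * dist (f x) (f y) ^ α := by
  obtain ⟨D, hD1, hD2⟩ : ∃ D, (upperBoxDim A).toReal < D ∧ D < k * (1 - α) / 2 :=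
    exists_between (by linarith)
  have hD : upperBoxDim A < ENNReal.ofReal D := by
    rwa [ENNReal.lt_ofReal_iff_toReal_lt hdim]
  obtain ⟨a, ha⟩ := (ae_eventually_notMem_collapsingMatrices (α := α) hD (by linarith)).exists
  obtain ⟨J, hJ⟩ := eventually_atTop.1 ha
  have hmem : ∀ (x : Cube m) (r : Fin k), (∑ j, (a r j : ℝ) * x j) / m ∈ I := by
    intro x r
    have h0 : 0 ≤ ∑ j, (a r j : ℝ) * x j :=
      Finset.sum_nonneg fun j _ => mul_nonneg (a r j).2.1 (x j).2.1
    refine ⟨by positivity, div_le_one_of_le₀ ?_ (Nat.cast_nonneg m)⟩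
    refine (Finset.sum_le_sum fun j _ => mul_le_one₀ (a r j).2.2 (x j).2.1 (x j).2.2).trans ?_
    simp
  -- Dividing by `m` keeps the values in `[0,1]`, since all entries of `a` lie in `[0,1]`.
  let f : Cube m → Cube k := fun x r => ⟨(∑ j, (a r j : ℝ) * x j) / m, hmem x r⟩
  set β : ℝ := (1 / 2 : ℝ) ^ α with hβ
  have hβ0 : 0 < β := by positivity
  have hβ1 : β < 1 := Real.rpow_lt_one (by norm_num) (by norm_num) hα0
  have hpow : ∀ j : ℕ, ((1 / 2 : ℝ) ^ j) ^ α = β ^ j := by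
    intro j
    rw [hβ, ← Real.rpow_natCast, ← Real.rpow_mul (by norm_num), mul_comm,
      Real.rpow_mul (by norm_num), Real.rpow_natCast]
  refine ⟨f, ⟨LinearMap.pi fun r => (m : ℝ)⁻¹ • ∑ j, (a r j : ℝ) • LinearMap.proj j, ?_⟩,
    max 1 ((β ^ (J + 1))⁻¹ * (m : ℝ) ^ α), le_max_left _ _, ?_⟩
  · intro x r
    simp [f, div_eq_inv_mul]
  intro x hx y hy
  rcases eq_or_lt_of_le (dist_nonneg (x := x) (y := y)) with h0 | h0
  · rw [← h0]
    positivity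
  have hle1 : dist x y ≤ 1 := (dist_pi_le_iff zero_le_one).2 fun i => by
    rw [Subtype.dist_eq, Real.dist_eq]
    exact abs_le.2 ⟨by linarith [(x i).2.1, (y i).2.2], by linarith [(x i).2.2, (y i).2.1]⟩
  -- Locate the distance between consecutive powers of `β = 2 ^ (-α)`. Going `J` scales further
  -- reaches the range where `a` does not collapse, and costs only the factor `(β ^ (J + 1))⁻¹`.
  obtain ⟨n, hn1, hn2⟩ := exists_nat_pow_near_of_lt_one h0 hle1 hβ0 hβ1
  have hsep := hJ (n + 1 + J) (by omega)
  have hfar : ((1 / 2 : ℝ) ^ (n + 1 + J)) ^ α ≤ dist x y := by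
    rw [hpow]
    exact (pow_le_pow_of_le_one hβ0.le hβ1.le (by omega)).trans hn1.le
  obtain ⟨r, hr⟩ : ∃ r, (1 / 2 : ℝ) ^ (n + 1 + J) <
      |∑ j, (a r j : ℝ) * ((x j : ℝ) - y j)| := by
    by_contra! hcon
    exact hsep ⟨x, hx, y, hy, hfar, hcon⟩
  have hm : (m : ℝ) ≠ 0 := by
    rintro hm
    obtain rfl : m = 0 := by exact_mod_cast hm
    rw [Subsingleton.elim x y, dist_self] at h0
    exact h0.false
  have hsum : |∑ j, (a r j : ℝ) * ((x j : ℝ) - y j)| ≤ m * dist (f x) (f y) := by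
    have h1 : |(f x r : ℝ) - f y r| ≤ dist (f x) (f y) := dist_le_pi_dist (f x) (f y) r
    refine le_of_eq_of_le ?_ (mul_le_mul_of_nonneg_left h1 (Nat.cast_nonneg m))
    have heq : ∑ j, (a r j : ℝ) * ((x j : ℝ) - y j) = m * ((f x r : ℝ) - f y r) := by
      simp only [f, mul_sub, Finset.sum_sub_distrib, mul_div_cancel₀ _ hm]
    rw [heq, abs_mul, Nat.abs_cast]
  calc dist x y ≤ β ^ n := hn2
    _ = (β ^ (J + 1))⁻¹ * β ^ (n + 1 + J) := by
      field_simp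
      ring
    _ ≤ (β ^ (J + 1))⁻¹ * (m * dist (f x) (f y)) ^ α := by
      rw [← hpow (n + 1 + J)]
      gcongr
      exact hr.le.trans hsum
    _ = (β ^ (J + 1))⁻¹ * (m : ℝ) ^ α * dist (f x) (f y) ^ α := by
      rw [Real.mul_rpow (by positivity) dist_nonneg, mul_assoc]
    _ ≤ _ := by
      gcongr
      exact le_max_right _ _

/-- McShane extension of the inverse of `f` on `A`. -/
theorem exists_holder_leftInvOn {m k : ℕ} {A : Set (Cube m)} {f : Cube m → Cube k} {α L : ℝ}
    (hα0 : 0 < α) (hα1 : α ≤ 1) (hL : 0 ≤ L)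
    (hf : ∀ x ∈ A, ∀ y ∈ A, dist x y ≤ L * dist (f x) (f y) ^ α) :
    ∃ g : Cube k → Cube m, LeftInvOn g f A ∧ ∀ u v, dist (g u) (g v) ≤ L * dist u v ^ α := by
  rcases A.eq_empty_or_nonempty with rfl | hA
  · refine ⟨fun _ _ => 0, fun _ h => h.elim, fun u v => ?_⟩
    rw [dist_self]
    positivity
  have : Nonempty A := hA.to_subtype
  -- Coordinatewise McShane formula; truncation at `0` keeps the supremum in `[0,1]`.
  let φ : Fin m → Cube k → A → ℝ := fun i u a => max 0 ((a.1 i : ℝ) - L * dist u (f a) ^ α)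
  have hφ1 : ∀ i u a, φ i u a ≤ 1 := fun i u a => max_le zero_le_one
    ((sub_le_self _ (by positivity)).trans (a.1 i).2.2)
  have hbdd : ∀ i u, BddAbove (range (φ i u)) := fun i u => ⟨1, by
    rintro _ ⟨a, rfl⟩
    exact hφ1 i u a⟩
  have hmem : ∀ i u, ⨆ a, φ i u a ∈ I := fun i u =>
    ⟨Real.iSup_nonneg fun a => le_max_left _ _, ciSup_le (hφ1 i u)⟩
  have hmono : ∀ i u v, ⨆ a, φ i u a ≤ (⨆ a, φ i v a) + L * dist u v ^ α := by
    intro i u v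
    refine ciSup_le fun a => ?_
    -- `dist ^ α` satisfies the triangle inequality because `α ≤ 1`.
    have hsub : dist v (f a) ^ α ≤ dist u v ^ α + dist u (f a) ^ α := by
      refine (Real.rpow_le_rpow dist_nonneg (dist_triangle_left v (f a) u) hα0.le).trans ?_
      exact Real.rpow_add_le_add_rpow dist_nonneg dist_nonneg hα0.le hα1
    have hmul := mul_le_mul_of_nonneg_left hsub hL
    have h1 := le_ciSup (hbdd i v) a
    have h2 : 0 ≤ L * dist u v ^ α := by positivity
    refine max_le ?_ ?_
    · linarith [le_max_left 0 ((a.1 i : ℝ) - L * dist v (f a) ^ α)]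
    · linarith [le_max_right 0 ((a.1 i : ℝ) - L * dist v (f a) ^ α)]
  refine ⟨fun u i => ⟨⨆ a, φ i u a, hmem i u⟩, fun x hx => ?_, fun u v => ?_⟩
  · funext i
    refine Subtype.ext (le_antisymm (ciSup_le fun a => max_le (x i).2.1 ?_) ?_)
    · have h1 : |(a.1 i : ℝ) - x i| ≤ dist a.1 x := dist_le_pi_dist a.1 x i
      have h2 := hf a a.2 x hx
      rw [dist_comm (f a)] at h2
      linarith [le_abs_self ((a.1 i : ℝ) - x i)]
    · refine le_trans ?_ (le_ciSup (hbdd i (f x)) ⟨x, hx⟩)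
      refine le_max_of_le_right ?_
      simp [Real.zero_rpow hα0.ne']
  · refine (dist_pi_le_iff (by positivity)).2 fun i => ?_
    rw [Subtype.dist_eq, Real.dist_eq, abs_sub_le_iff]
    have h1 := hmono i u v
    have h2 := hmono i v u
    rw [dist_comm v u] at h2
    exact ⟨by linarith, by linarith⟩

/-! ### Blockwise coding and its Hölder constant -/

/-- Positions in a word consisting of `q` blocks of length `m` and a remainder of length `r`. -/
def blockIndex (q m r : ℕ) : (Fin q × Fin m) ⊕ Fin r ≃ Fin (q * m + r) :=
  (Equiv.sumCongr finProdFinEquiv (Equiv.refl _)).trans finSumFinEquiv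

/-- The `j`-th block of length `m`. -/
def block {q m r : ℕ} {X : Type*} (x : Fin (q * m + r) → X) (j : Fin q) : Fin m → X :=
  fun b => x (blockIndex q m r (Sum.inl (j, b)))

/-- The map applying `f` to every block and keeping the remainder. -/
def blockMap (q r : ℕ) {m k : ℕ} {X : Type*} (f : (Fin m → X) → Fin k → X)
    (x : Fin (q * m + r) → X) : Fin (q * k + r) → X :=
  fun i => Sum.elim (fun j => f (block x j.1) j.2) (fun s => x (blockIndex q m r (Sum.inr s)))
    ((blockIndex q k r).symm i)

theorem blockMap_inl {q r m k : ℕ} {X : Type*} (f : (Fin m → X) → Fin k → X)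
    (x : Fin (q * m + r) → X) (j : Fin q × Fin k) :
    blockMap q r f x (blockIndex q k r (Sum.inl j)) = f (block x j.1) j.2 := by
  simp [blockMap]

theorem blockMap_inr {q r m k : ℕ} {X : Type*} (f : (Fin m → X) → Fin k → X)
    (x : Fin (q * m + r) → X) (s : Fin r) :
    blockMap q r f x (blockIndex q k r (Sum.inr s)) = x (blockIndex q m r (Sum.inr s)) := by
  simp [blockMap]

theorem block_blockMap {q r m k : ℕ} {X : Type*} (f : (Fin m → X) → Fin k → X)
    (x : Fin (q * m + r) → X) (j : Fin q) : block (blockMap q r f x) j = f (block x j) :=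
  funext fun b => blockMap_inl f x (j, b)

theorem blockMap_blockMap_eq_self {q r m k : ℕ} {X : Type*} {f : (Fin m → X) → Fin k → X}
    {g : (Fin k → X) → Fin m → X} {A : Set (Fin m → X)} (h : LeftInvOn g f A)
    {x : Fin (q * m + r) → X} (hx : ∀ j, block x j ∈ A) :
    blockMap q r g (blockMap q r f x) = x := by
  funext i
  obtain ⟨j | s, rfl⟩ := (blockIndex q m r).surjective i
  · rw [blockMap_inl, block_blockMap, h (hx j.1)]
    rfl
  · rw [blockMap_inr, blockMap_inr]

theorem blockMap_mem_linearClass {m k : ℕ} {f : Cube m → Cube k} (hf : f ∈ linearClass m k)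
    (q r : ℕ) : blockMap q r f ∈ linearClass (q * m + r) (q * k + r) := by
  obtain ⟨F, hF⟩ := hf
  refine ⟨LinearMap.pi fun i => Sum.elim
    (fun j => LinearMap.proj j.2 ∘ₗ F ∘ₗ
      LinearMap.funLeft ℝ ℝ fun b => blockIndex q m r (Sum.inl (j.1, b)))
    (fun s => LinearMap.proj (blockIndex q m r (Sum.inr s))) ((blockIndex q k r).symm i), ?_⟩
  intro x i
  obtain ⟨j | s, rfl⟩ := (blockIndex q k r).surjective i
  · rw [blockMap_inl, hF, LinearMap.pi_apply, Equiv.symm_apply_apply]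
    rfl
  · rw [blockMap_inr, LinearMap.pi_apply, Equiv.symm_apply_apply]
    rfl

theorem sum_blockIndex {q m r : ℕ} (w : Fin (q * m + r) → ℝ) :
    ∑ i, w i = ∑ j, ∑ b, w (blockIndex q m r (Sum.inl (j, b))) +
      ∑ s, w (blockIndex q m r (Sum.inr s)) := by
  rw [← (blockIndex q m r).sum_comp, Fintype.sum_sum_type, Fintype.sum_prod_type]

theorem abs_coe_sub_coe_le_one (a b : I) : |(a : ℝ) - b| ≤ 1 :=
  abs_le.2 ⟨by linarith [a.2.1, b.2.2], by linarith [a.2.2, b.2.1]⟩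

/-- In each block the maximum distance is attained at one coordinate `c`. It controls all `m` output
coordinates, and its term is at most the sum over the block. On the remainder, `s ≤ s ^ α` for `s ∈
[0,1]`. -/
theorem sum_rpow_abs_blockMap_sub_le {k m q r : ℕ} (hk : 0 < k) (hm : 0 < m)
    {g : Cube k → Cube m} {α L t : ℝ} (hα0 : 0 < α) (hα1 : α ≤ 1) (hL : 1 ≤ L) (ht : 1 ≤ t)
    (hg : ∀ u v, dist (g u) (g v) ≤ L * dist u v ^ α) (x y : Cube (q * k + r)) :
    ∑ i, |((blockMap q r g x i : I) : ℝ) - (blockMap q r g y i : I)| ^ t ≤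
      m * L ^ t * ∑ i, (|(x i : ℝ) - y i| ^ t) ^ α := by
  have : Nonempty (Fin k) := ⟨⟨0, hk⟩⟩
  have hone : 1 ≤ m * L ^ t :=
    one_le_mul_of_one_le_of_one_le (by exact_mod_cast hm) (Real.one_le_rpow hL (by linarith))
  rw [sum_blockIndex, sum_blockIndex, mul_add]
  refine add_le_add ?_ ?_
  · rw [Finset.mul_sum]
    refine Finset.sum_le_sum fun j _ => ?_
    obtain ⟨c, hc⟩ := Finite.exists_max fun c => dist (block x j c) (block y j c)
    have hd : dist (block x j) (block y j) ≤ dist (block x j c) (block y j c) :=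
      (dist_pi_le_iff dist_nonneg).2 hc
    have hterm : ∀ b : Fin m, |(g (block x j) b : ℝ) - g (block y j) b| ^ t ≤
        L ^ t * (dist (block x j c) (block y j c) ^ t) ^ α := by
      intro b
      have h1 : |(g (block x j) b : ℝ) - g (block y j) b| ≤
          L * dist (block x j c) (block y j c) ^ α := by
        refine (dist_le_pi_dist (g (block x j)) (g (block y j)) b).trans ((hg _ _).trans ?_)
        gcongr
      refine (Real.rpow_le_rpow (abs_nonneg _) h1 (by linarith)).trans (le_of_eq ?_)
      rw [Real.mul_rpow (by linarith) (by positivity), ← Real.rpow_mul dist_nonneg,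
        ← Real.rpow_mul dist_nonneg, mul_comm α]
    simp only [blockMap_inl]
    refine (Finset.sum_le_sum fun b _ => hterm b).trans ?_
    rw [Finset.sum_const, Finset.card_univ, Fintype.card_fin, nsmul_eq_mul, ← mul_assoc]
    refine mul_le_mul_of_nonneg_left ?_ (by linarith)
    exact Finset.single_le_sum
      (f := fun b => (|((block x j b : I) : ℝ) - (block y j b : I)| ^ t) ^ α)
      (fun b _ => by positivity) (Finset.mem_univ c)
  · simp only [blockMap_inr]
    refine le_trans (Finset.sum_le_sum fun s _ => ?_)
      (le_mul_of_one_le_left (Finset.sum_nonneg fun s _ => by positivity) hone)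
    exact Real.self_le_rpow_of_le_one (by positivity)
      (Real.rpow_le_one (abs_nonneg _) (abs_coe_sub_coe_le_one _ _) (by linarith)) hα1

/-- Jensen's inequality for the concave function `s ↦ s ^ α`. -/
theorem mean_rpow_le {n : ℕ} (hn : 0 < n) {v : Fin n → ℝ} (hv : ∀ i, 0 ≤ v i) {α : ℝ}
    (hα0 : 0 ≤ α) (hα1 : α ≤ 1) :
    ∑ i, v i ^ α ≤ n * ((1 / (n : ℝ)) * ∑ i, v i) ^ α := by
  have hn' : (0 : ℝ) < n := by exact_mod_cast hn
  have h := (Real.concaveOn_rpow hα0 hα1).le_map_sum (t := Finset.univ)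
    (w := fun _ : Fin n => 1 / (n : ℝ)) (p := v) (fun _ _ => by positivity)
    (by simp [hn'.ne']) (fun i _ => hv i)
  simp only [smul_eq_mul, ← Finset.mul_sum] at h
  rwa [one_div, inv_mul_le_iff₀ hn', ← one_div] at h

/-- For finite `p`, the factor `m` comes from the sum over output coordinates and `k` bounds the
ratio of the word lengths that normalize the two distances. Neither involves `q` or `r`, so the
constant is uniform in the word length. -/
theorem blockMap_mem_holderClass {k m q r : ℕ} (hk : 0 < k) (hm : 0 < m) (hqr : 0 < q * k + r)
    {g : Cube k → Cube m} {α L : ℝ} (hα0 : 0 < α) (hα1 : α ≤ 1) (hL : 1 ≤ L)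
    (hg : ∀ u v, dist (g u) (g v) ≤ L * dist u v ^ α) {p : ℝ≥0∞} (hp : 1 ≤ p) :
    blockMap q r g ∈ holderClass p (m * k * L) α (q * k + r) (q * m + r) := by
  intro x y
  have hmk : (1 : ℝ) ≤ m * k := by exact_mod_cast Nat.mul_pos hm hk
  have hLmk : L ≤ m * k * L := le_mul_of_one_le_left (by linarith) hmk
  have hL1 : 1 ≤ m * k * L := hL.trans hLmk
  rcases eq_or_ne p ∞ with rfl | hp'
  · simp only [lpDist, if_true]
    refine (dist_pi_le_iff (by positivity)).2 fun i => ?_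
    obtain ⟨j | s, rfl⟩ := (blockIndex q m r).surjective i
    · rw [blockMap_inl, blockMap_inl]
      refine (dist_le_pi_dist _ _ _).trans ((hg _ _).trans ?_)
      have : dist (block x j.1) (block y j.1) ≤ dist x y :=
        (dist_pi_le_iff dist_nonneg).2 fun b => dist_le_pi_dist x y _
      gcongr
    · rw [blockMap_inr, blockMap_inr]
      refine le_trans ?_ (le_mul_of_one_le_left (by positivity) hL1)
      refine (Real.self_le_rpow_of_le_one dist_nonneg (abs_coe_sub_coe_le_one _ _) hα1).trans ?_
      gcongr
      exact dist_le_pi_dist x y _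
  · have ht : 1 ≤ p.toReal := by
      rw [← ENNReal.toReal_one]
      exact ENNReal.toReal_mono hp' hp
    simp only [lpDist, if_neg hp']
    generalize p.toReal = t at ht
    have ht0 : 0 < t := by linarith
    set T : ℝ := (1 / ((q * k + r : ℕ) : ℝ)) * ∑ i, |(x i : ℝ) - y i| ^ t with hT
    have hT0 : 0 ≤ T := by positivity
    have hcard : q * k + r ≤ k * (q * m + r) := by nlinarith [Nat.zero_le (q * k)]
    have hN : 0 < q * m + r := Nat.pos_of_mul_pos_left (hqr.trans_le hcard)
    have hratio : (1 / ((q * m + r : ℕ) : ℝ)) * ((q * k + r : ℕ) : ℝ) ≤ k := by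
      rw [one_div, inv_mul_le_iff₀ (by exact_mod_cast hN), mul_comm ((q * m + r : ℕ) : ℝ)]
      exact_mod_cast hcard
    have hsum : (1 / ((q * m + r : ℕ) : ℝ)) *
        ∑ i, |((blockMap q r g x i : I) : ℝ) - (blockMap q r g y i : I)| ^ t ≤
          (m * k * L) ^ t * T ^ α := by
      calc (1 / ((q * m + r : ℕ) : ℝ)) *
            ∑ i, |((blockMap q r g x i : I) : ℝ) - (blockMap q r g y i : I)| ^ t
          ≤ (1 / ((q * m + r : ℕ) : ℝ)) * (m * L ^ t * (((q * k + r : ℕ) : ℝ) * T ^ α)) := by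
            gcongr
            refine (sum_rpow_abs_blockMap_sub_le hk hm hα0 hα1 hL ht hg x y).trans ?_
            gcongr
            exact mean_rpow_le hqr (fun i => by positivity) hα0.le hα1
        _ = (1 / ((q * m + r : ℕ) : ℝ)) * ((q * k + r : ℕ) : ℝ) * (m * L ^ t * T ^ α) := by ring
        _ ≤ k * (m * L ^ t * T ^ α) := by gcongr
        _ = (m * k) * L ^ t * T ^ α := by ring
        _ ≤ (m * k) ^ t * L ^ t * T ^ α := by
            gcongr
            exact Real.self_le_rpow_of_one_le hmk ht
        _ = (m * k * L) ^ t * T ^ α := by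
            rw [Real.mul_rpow (x := m * k) (by positivity) (by linarith)]
    refine (Real.rpow_le_rpow (by positivity) hsum (by positivity)).trans (le_of_eq ?_)
    rw [Real.mul_rpow (by positivity) (by positivity), ← Real.rpow_mul (by positivity),
      mul_one_div_cancel ht0.ne', Real.rpow_one, ← Real.rpow_mul hT0, ← Real.rpow_mul hT0,
      mul_comm α]

/-! ### From one block to the compression rate -/

theorem block_word_mem (S : UnitSubshift) {q m r : ℕ} {x : ℤ → I} (hx : x ∈ S.carrier)
    (j : Fin q) : block (word (q * m + r) x) j ∈ word m '' S.carrier := by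
  refine ⟨_, S.mapsTo ((m * j : ℕ) : ℤ) hx, ?_⟩
  funext b
  simp [word, block, blockIndex, SymbolicDynamics.FullShift.shift, add_comm]

/-- Writing `n = q * m + r` with `r < m`, the blocks contribute `q * k / n ≤ k / m` and the copied
remainder `r / n ≤ m / n`. The set of wrongly decoded points of `S` is empty, hence null for every
measure. -/
theorem blockRate_le (S : UnitSubshift) {m k : ℕ} (hm : 0 < m) (hk : 0 < k)
    {f : Cube m → Cube k} {g : Cube k → Cube m} (hf : f ∈ linearClass m k)
    (hfg : LeftInvOn g f (word m '' S.carrier)) {α L : ℝ} (hα0 : 0 < α) (hα1 : α ≤ 1)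
    (hL : 1 ≤ L) (hg : ∀ u v, dist (g u) (g v) ≤ L * dist u v ^ α) {p : ℝ≥0∞} (hp : 1 ≤ p)
    {n : ℕ} (hn : 0 < n) :
    blockRate linearClass (holderClass p (m * k * L) α) S 0 n ≤
      (k : ℝ≥0∞) / m + (m : ℝ≥0∞) / n := by
  obtain ⟨q, r, hr, rfl⟩ : ∃ q r, r < m ∧ n = q * m + r :=
    ⟨n / m, n % m, Nat.mod_lt n hm, (Nat.div_add_mod' n m).symm⟩
  have hqr : 0 < q * k + r := by
    rcases Nat.eq_zero_or_pos q with rfl | hq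
    · simpa using hn
    · positivity
  have hm0 : (m : ℝ≥0∞) ≠ 0 := by exact_mod_cast hm.ne'
  refine (iInf₂_le (q * k + r) ⟨hqr, blockMap q r f, blockMap_mem_linearClass hf q r,
    blockMap q r g, blockMap_mem_holderClass hk hm hqr hα0 hα1 hL hg hp, ?_⟩).trans ?_
  · rw [Nat.cast_add (q * k), ENNReal.add_div]
    refine add_le_add (ENNReal.div_le_of_le_mul ?_) ?_
    · calc ((q * k : ℕ) : ℝ≥0∞) = (k : ℝ≥0∞) / m * m * q := by
            rw [ENNReal.div_mul_cancel hm0 (ENNReal.natCast_ne_top m)]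
            push_cast
            ring
        _ = (k : ℝ≥0∞) / m * ((q * m : ℕ) : ℝ≥0∞) := by
            push_cast
            ring
        _ ≤ (k : ℝ≥0∞) / m * ((q * m + r : ℕ) : ℝ≥0∞) := by
            gcongr
            omega
    · gcongr
  · intro μ _
    refine le_of_eq_of_le ?_ zero_le
    convert measure_empty (μ := μ)
    refine eq_empty_of_forall_notMem ?_
    rintro x ⟨hx, hne⟩
    exact hne (blockMap_blockMap_eq_self hfg (block_word_mem S hx))

theorem iInf_uniformRate_le (S : UnitSubshift) {m k : ℕ} (hm : 0 < m) (hk : 0 < k) {α : ℝ}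
    (hα0 : 0 < α) (hα1 : α < 1) {p : ℝ≥0∞} (hp : 1 ≤ p)
    (hdim : upperBoxDim (word m '' S.carrier) ≠ ∞)
    (hlt : 2 * (upperBoxDim (word m '' S.carrier)).toReal < k * (1 - α)) :
    (⨅ (L : ℝ) (_ : 0 < L), uniformRate linearClass (holderClass p L α) S 0) ≤
      (k : ℝ≥0∞) / m := by
  obtain ⟨f, hf, L, hL, hfL⟩ := exists_linear_holder_embedding hα0 hdim hlt
  obtain ⟨g, hfg, hg⟩ := exists_holder_leftInvOn hα0 hα1.le (by linarith) hfL
  refine (iInf₂_le ((m : ℝ) * k * L) (by positivity)).trans ?_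
  have hlim : Tendsto (fun n : ℕ => (k : ℝ≥0∞) / m + (m : ℝ≥0∞) / n) atTop
      (𝓝 ((k : ℝ≥0∞) / m)) := by
    simpa using tendsto_const_nhds.add
      (ENNReal.Tendsto.const_div ENNReal.tendsto_nat_nhds_top (Or.inr (ENNReal.natCast_ne_top m)))
  refine le_of_le_of_eq (limsup_le_limsup ?_) hlim.limsup_eq
  filter_upwards [eventually_gt_atTop 0] with n hn
  exact blockRate_le S hm hk hf hfg hα0 hα1.le hL hg hp hn

end AnalogCompression

open AnalogCompression in
theorem theorem5p2p1 (S : AnalogCompression.UnitSubshift) (α : ℝ) (hα0 : 0 < α) (hα1 : α < 1)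
    (p : ℝ≥0∞) (hp : 1 ≤ p) :
    (⨅ (L : ℝ) (_ : 0 < L), AnalogCompression.uniformRate AnalogCompression.linearClass
        (AnalogCompression.holderClass p L α) S 0) ≤
      ENNReal.ofReal (2 / (1 - α)) * AnalogCompression.meanBoxDim S := by
  refine le_of_forall_gt fun c hc => ?_
  have hα : 0 < 1 - α := by linarith
  set C : ℝ≥0∞ := ENNReal.ofReal (2 / (1 - α)) with hC
  have hC0 : C ≠ 0 := (ENNReal.ofReal_pos.2 (by positivity)).ne'
  have hlim : Tendsto (fun n : ℕ => C * (upperBoxDim (word n '' S.carrier) / (n : ℝ≥0∞)) +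
      1 / (n : ℝ≥0∞)) atTop (𝓝 (C * meanBoxDim S)) := by
    simpa using (ENNReal.Tendsto.const_mul (tendsto_meanBoxDim S)
      (Or.inr ENNReal.ofReal_ne_top)).add (ENNReal.Tendsto.const_div (a := 1)
        ENNReal.tendsto_nat_nhds_top (Or.inr ENNReal.one_ne_top))
  -- The term `1 / m` in `hlim` reserves room for rounding `k` up to an integer.
  obtain ⟨m, hmc, hm⟩ := ((hlim.eventually_lt_const hc).and (eventually_gt_atTop 0)).exists
  have hdim : upperBoxDim (word m '' S.carrier) ≠ ∞ := by
    intro htop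
    rw [htop, ENNReal.top_div_of_ne_top (ENNReal.natCast_ne_top m), ENNReal.mul_top hC0,
      top_add] at hmc
    exact not_top_lt hmc
  set d : ℝ := (upperBoxDim (word m '' S.carrier)).toReal with hd
  have hd0 : 0 ≤ 2 / (1 - α) * d := by positivity
  -- Taking floor plus one rather than the ceiling gives the strict inequality and `k ≥ 1` even when
  -- `2 / (1 - α) * d` is an integer, including `0`.
  refine lt_of_le_of_lt (iInf_uniformRate_le S hm (Nat.succ_pos ⌊2 / (1 - α) * d⌋₊) hα0 hα1 hp
    hdim ?_) (lt_of_le_of_lt ?_ hmc)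
  · have h := Nat.lt_succ_floor (2 / (1 - α) * d)
    rw [← div_lt_iff₀ hα, ← div_mul_eq_mul_div]
    exact h
  · rw [← mul_div_assoc, ← ENNReal.add_div]
    gcongr
    rw [Nat.cast_succ, ← ENNReal.ofReal_toReal hdim, ← hd, hC,
      ← ENNReal.ofReal_mul (by positivity), ← ENNReal.ofReal_natCast]
    gcongr
    exact Nat.floor_le hd0
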